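/- Let $k$ be a commutative ring with identity, let $\lambda,\kappa\in k$, and let $\mu\in k$ satisfy $\mu^2-\lambda\mu+\kappa=0$. An extended Rota-Baxter operator of weight $(\lambda,\kappa)$ on a $k$-algebra $S$ is a $k$-linear map $Q:S\to S$ with $Q(x)Q(y)=Q(xQ(y))+Q(Q(x)y)+\lambda Q(xy)+\kappa xy$ for all $x,y\in S$; a homomorphism $(S,Q)\to(S',Q')$ is an algebra homomorphism $F$ with $F\circ Q=Q'\circ F$. Let $(A,\Delta_A,\varepsilon_A)$ be a $k$-bialgebra with commutative multiplication and unit $1_A$. Let $\mathrm{Sh}_e(A)=\bigoplus_{n\ge 1}A^{\otimes n}$, let $j:A\to \mathrm{Sh}_e(A)$ be the inclusion of the first summand, let $P(\mathfrak a)=1_A\otimes\mathfrak a$ be the right-shift operator, and give $\mathrm{Sh}_e(A)$ the commutative product $\diamond$ with unit $1_A$ defined recursively on pure tensors by $a\diamond b=ab$, $a\diamond(b\otimes\mathfrak b)=(b\otimes\mathfrak b)\diamond a=ab\otimes\mathfrak b$ and $$(a\otimes\mathfrak a)\diamond(b\otimes\mathfrak b)=ab\otimes\big(\mathfrak a\diamond(1_A\otimes\mathfrak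 b)+(1_A\otimes\mathfrak a)\diamond\mathfrak b+\lambda\,\mathfrak a\diamond\mathfrak b\big)+\kappa\,ab\,(\mathfrak a\diamond\mathfrak b)$$ for $a,b\in A$, where in the last term $ab$ is multiplied into the first tensor factor. Then $(\mathrm{Sh}_e(A),\diamond,P)$ together with $j$ is the free commutative extended Rota-Baxter algebra of weight $(\lambda,\kappa)$ on $A$. Let $\varepsilon:\mathrm{Sh}_e(A)\to k$ be the unique homomorphism of extended Rota-Baxter algebras $(\mathrm{Sh}_e(A),P)\to(k,-\mu\,\mathrm{id})$ with $\varepsilon\circ j=\varepsilon_A$. Let $\bar P$ be the operator on $\mathrm{Sh}_e(A)\otimes \mathrm{Sh}_e(A)$ given by $$\bar P(\mathfrak a\otimes\mathfrak b)=P(\mathfrak a)\otimes\varepsilon(\mathfrak b)1_A+\mu\,\mathfrak a\otimes\varepsilon(\mathfrak b)1_A+\mathfrak a\otimes P(\mathfrak b),$$ which is an extended Rota-Baxter operator of weight $(\lambda,\kappa)$, and let $\Delta:\mathrm{Sh}_e(A)\to \mathrm{Sh}_e(A)\otimes \mathrm{Sh}_e(A)$ be the unique homomorphism of extended Rota-Baxter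 algebras $(\mathrm{Sh}_e(A),P)\to(\mathrm{Sh}_e(A)\otimes \mathrm{Sh}_e(A),\bar P)$ with $\Delta\circ j=(j\otimes j)\circ\Delta_A$. Then for all $\mathfrak a\in \mathrm{Sh}_e(A)$, $$\Delta(P(\mathfrak a))=\big(P(\mathfrak a)+\mu\,\mathfrak a\big)\otimes 1_A+(\mathrm{id}\otimes P)\,\Delta(\mathfrak a).$$ -/

import Mathlib

open scoped TensorProduct DirectSum

noncomputable section

namespace ExtendedRotaBaxter

/-- An extended Rota-Baxter operator of weight `(lam, kap)` on an `R`-algebra `S`: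
an `R`-linear map `P : S → S` with
`P(x)P(y) = P(xP(y)) + P(P(x)y) + lam P(xy) + kap xy`. -/
def IsExtendedRotaBaxter {R S : Type*} [CommRing R] [Ring S] [Algebra R S] (lam kap : R)
    (P : S →ₗ[R] S) : Prop :=
  ∀ x y : S, P x * P y = P (x * P y) + P (P x * y) + lam • P (x * y) + kap • (x * y)

section TensorPowers

variable {R A N : Type*} [CommRing R] [CommRing A] [Algebra R A] [AddCommGroup N] [Module R N]

/-- `a ⊗ (a₁ ⊗ ⋯ ⊗ aₙ) ↦ a ⊗ a₁ ⊗ ⋯ ⊗ aₙ`. -/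
def consT (n : ℕ) : A →ₗ[R] (⨂[R]^n A) →ₗ[R] (⨂[R]^(n + 1) A) :=
  (PiTensorProduct.lift (R := R) (s := fun _ : Fin n => A)).toLinearMap ∘ₗ
    (PiTensorProduct.tprod R (s := fun _ : Fin (n + 1) => A)).curryLeft

/-- The linear map on `A^{⊗(n+1)}` with `a ⊗ u ↦ G a u` for `u ∈ A^{⊗n}`. -/
def unconsT {n : ℕ} (G : A →ₗ[R] (⨂[R]^n A) →ₗ[R] N) : (⨂[R]^(n + 1) A) →ₗ[R] N :=
  PiTensorProduct.lift (LinearMap.uncurryLeft (M := fun _ : Fin (n + 1) => A)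
    ((PiTensorProduct.lift (R := R) (s := fun _ : Fin n => A)).symm.toLinearMap ∘ₗ G))

theorem consT_tprod (n : ℕ) (a : A) (v : Fin n → A) :
    consT (R := R) n a (PiTensorProduct.tprod R v) =
      PiTensorProduct.tprod R (Fin.cons a v : Fin (n + 1) → A) := by
  simp [consT]

theorem unconsT_tprod {n : ℕ} (G : A →ₗ[R] (⨂[R]^n A) →ₗ[R] N) (v : Fin (n + 1) → A) :
    unconsT G (PiTensorProduct.tprod R v) =
      G (v 0) (PiTensorProduct.tprod R (Fin.tail v)) := by
  simp [unconsT, PiTensorProduct.lift_symm]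

theorem unconsT_consT {n : ℕ} (G : A →ₗ[R] (⨂[R]^n A) →ₗ[R] N) (a : A) (u : ⨂[R]^n A) :
    unconsT G (consT n a u) = G a u := by
  have h : unconsT G ∘ₗ consT n a = G a := by
    apply PiTensorProduct.ext
    ext v
    simp [consT_tprod, unconsT_tprod]
  exact LinearMap.congr_fun h u

theorem unconsT_add {n : ℕ} (G H : A →ₗ[R] (⨂[R]^n A) →ₗ[R] N) :
    unconsT (G + H) = unconsT G + unconsT H := by
  apply PiTensorProduct.ext
  ext v
  simp [unconsT_tprod]

theorem unconsT_smul {n : ℕ} (c : R) (G : A →ₗ[R] (⨂[R]^n A) →ₗ[R] N) :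
    unconsT (c • G) = c • unconsT G := by
  apply PiTensorProduct.ext
  ext v
  simp [unconsT_tprod]

/-- The identification `A^{⊗1} = A`. -/
def oneT : (⨂[R]^1 A) ≃ₗ[R] A :=
  PiTensorProduct.subsingletonEquiv (R := R) (s := fun _ : Fin 1 => A) 0

end TensorPowers

/-- The module `A ⊕ A^{⊗2} ⊕ A^{⊗3} ⊕ ⋯`. The scalars `lam`, `kap` are carried along because
the product depends on them. -/
def Sha (R A : Type*) [CommRing R] [CommRing A] [Algebra R A] (_lam _kap : R) : Type _ :=
  ⨁ n : ℕ, ⨂[R]^(n + 1) A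

namespace Sha

variable {R A : Type*} [CommRing R] [CommRing A] [Algebra R A] {lam kap : R}

instance : AddCommGroup (Sha R A lam kap) :=
  inferInstanceAs (AddCommGroup (⨁ n : ℕ, ⨂[R]^(n + 1) A))

instance : Module R (Sha R A lam kap) :=
  inferInstanceAs (Module R (⨁ n : ℕ, ⨂[R]^(n + 1) A))

/-- The inclusion of the summand `A^{⊗(n+1)}`. -/
def incl (n : ℕ) : (⨂[R]^(n + 1) A) →ₗ[R] Sha R A lam kap :=
  DirectSum.lof R ℕ (fun n : ℕ => ⨂[R]^(n + 1) A) n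

/-- The linear map out of the direct sum with prescribed components. -/
def desc {N : Type*} [AddCommGroup N] [Module R N]
    (F : ∀ n : ℕ, (⨂[R]^(n + 1) A) →ₗ[R] N) : Sha R A lam kap →ₗ[R] N :=
  DirectSum.toModule R ℕ N F

theorem desc_incl {N : Type*} [AddCommGroup N] [Module R N]
    (F : ∀ n : ℕ, (⨂[R]^(n + 1) A) →ₗ[R] N) (n : ℕ) (x : ⨂[R]^(n + 1) A) :
    desc (lam := lam) (kap := kap) F (incl n x) = F n x :=
  DirectSum.toModule_lof (M := fun n : ℕ => ⨂[R]^(n + 1) A) R n x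

theorem hom_ext {N : Type*} [AddCommGroup N] [Module R N] {F G : Sha R A lam kap →ₗ[R] N}
    (h : ∀ n, F ∘ₗ incl n = G ∘ₗ incl n) : F = G :=
  DirectSum.linearMap_ext R h

/-- The embedding `A → Sha` onto the first summand, as a linear map. -/
def ofA : A →ₗ[R] Sha R A lam kap :=
  incl 0 ∘ₗ (oneT (R := R) (A := A)).symm.toLinearMap

/-- Concatenation `a ⊗ w` of `a ∈ A` and `w ∈ Sha`. -/
def cons : A →ₗ[R] Sha R A lam kap →ₗ[R] Sha R A lam kap :=
  LinearMap.flip (desc fun n => LinearMap.flip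
    ((LinearMap.compRight R (incl (n + 1))) ∘ₗ consT (n + 1)))

theorem cons_incl (a : A) (n : ℕ) (u : ⨂[R]^(n + 1) A) :
    cons a (incl n u) = (incl (n + 1) (consT (n + 1) a u) : Sha R A lam kap) := by
  simp [cons, desc_incl]

/-- The right-shift operator `P(w) = 1 ⊗ w`. -/
def shift : Sha R A lam kap →ₗ[R] Sha R A lam kap := cons 1

/-- Components of the map `act`. -/
def actAux : ∀ n : ℕ, (⨂[R]^(n + 1) A) →ₗ[R] A →ₗ[R] Sha R A lam kap
  | 0 => (LinearMap.compRight R ofA ∘ₗ LinearMap.mul R A) ∘ₗ oneT.toLinearMap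
  | n + 1 => unconsT (LinearMap.mk₂ R
      (fun b u => LinearMap.flip (cons ∘ₗ LinearMap.mul R A b) (incl n u))
      (by intros; ext; simp) (by intros; ext; simp)
      (by intros; ext; simp) (by intros; ext; simp))

/-- Multiplication of `a ∈ A` into the first tensor factor:
`a · (a₀ ⊗ a₁ ⊗ ⋯) = (a a₀) ⊗ a₁ ⊗ ⋯`. -/
def act : A →ₗ[R] Sha R A lam kap →ₗ[R] Sha R A lam kap :=
  LinearMap.flip (desc actAux)

theorem act_ofA (a b : A) : act a (ofA b) = (ofA (a * b) : Sha R A lam kap) := by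
  simp [act, ofA, desc_incl, actAux, mul_comm]

theorem act_cons (a b : A) (w : Sha R A lam kap) : act a (cons b w) = cons (a * b) w := by
  have h : act a ∘ₗ cons b = (cons (a * b) : Sha R A lam kap →ₗ[R] _) := by
    apply hom_ext
    intro n
    ext1
    ext v
    simp [cons_incl, act, desc_incl, actAux, unconsT_consT, mul_comm]
  exact LinearMap.congr_fun h w

/-- Given `R`-bilinear `B, C : A^{⊗m} × A^{⊗n} → Sha`, the `R`-bilinear map
`(a ⊗ u, b ⊗ v) ↦ ab ⊗ B(u, v) + kap ab · C(u, v)`. -/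
def mulStep {m n : ℕ} (B C : (⨂[R]^m A) →ₗ[R] (⨂[R]^n A) →ₗ[R] Sha R A lam kap) :
    (⨂[R]^(m + 1) A) →ₗ[R] (⨂[R]^(n + 1) A) →ₗ[R] Sha R A lam kap :=
  unconsT (LinearMap.mk₂ R
    (fun a u => unconsT (LinearMap.mk₂ R
      (fun b v => cons (a * b) (B u v) + kap • act (a * b) (C u v))
      (by intros; simp only [mul_add, map_add, LinearMap.add_apply, smul_add]; abel)
      (by intros; simp only [mul_smul_comm, map_smul, LinearMap.smul_apply, smul_add,
            smul_comm kap])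
      (by intros; simp only [map_add, smul_add]; abel)
      (by intros; simp only [map_smul, smul_add, smul_comm kap])))
    (by
      intro a a' u
      rw [← unconsT_add]; congr 1
      refine LinearMap.ext₂ fun b v => ?_
      simp only [add_mul, map_add, LinearMap.add_apply, smul_add, LinearMap.mk₂_apply]; abel)
    (by
      intro c a u
      rw [← unconsT_smul]; congr 1
      refine LinearMap.ext₂ fun b v => ?_
      simp only [smul_mul_assoc, map_smul, LinearMap.smul_apply, smul_add, LinearMap.mk₂_apply,
        smul_comm kap])
    (by
      intro a u u'
      rw [← unconsT_add]; congr 1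
      refine LinearMap.ext₂ fun b v => ?_
      simp only [map_add, LinearMap.add_apply, smul_add, LinearMap.mk₂_apply]; abel)
    (by
      intro c a u
      rw [← unconsT_smul]; congr 1
      refine LinearMap.ext₂ fun b v => ?_
      simp only [map_smul, LinearMap.smul_apply, smul_add, LinearMap.mk₂_apply,
        smul_comm kap]))

theorem mulStep_consT {m n : ℕ}
    (B C : (⨂[R]^m A) →ₗ[R] (⨂[R]^n A) →ₗ[R] Sha R A lam kap) (a b : A)
    (u : ⨂[R]^m A) (v : ⨂[R]^n A) :
    mulStep B C (consT m a u) (consT n b v) =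
      cons (a * b) (B u v) + kap • act (a * b) (C u v) := by
  rw [mulStep, unconsT_consT, LinearMap.mk₂_apply, unconsT_consT, LinearMap.mk₂_apply]

/-- The product of `A^{⊗(m+1)}` and `A^{⊗(n+1)}`, by recursion on `m + n`:
`(a ⊗ u) ⋄ (b ⊗ v) = ab ⊗ (u ⋄ (1 ⊗ v) + (1 ⊗ u) ⋄ v + lam (u ⋄ v)) + kap ab (u ⋄ v)`,
and an element of `A` is multiplied into the first factor of the other argument. -/
def mulAux : ∀ m n : ℕ,
    (⨂[R]^(m + 1) A) →ₗ[R] (⨂[R]^(n + 1) A) →ₗ[R] Sha R A lam kap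
  | 0, n => LinearMap.lcomp R _ (incl n) ∘ₗ act ∘ₗ oneT.toLinearMap
  | m + 1, 0 =>
      LinearMap.flip (LinearMap.lcomp R _ (incl (m + 1)) ∘ₗ act ∘ₗ oneT.toLinearMap)
  | m + 1, n + 1 =>
      mulStep
        (LinearMap.compl₂ (mulAux m (n + 1)) (consT (n + 1) 1)
          + mulAux (m + 1) n ∘ₗ consT (m + 1) 1
          + lam • mulAux m n)
        (mulAux m n)
  termination_by m n => m + n

/-- The product of `Sha`, extended bilinearly. -/
def mulL : Sha R A lam kap →ₗ[R] Sha R A lam kap →ₗ[R] Sha R A lam kap :=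
  desc fun m => LinearMap.flip (desc fun n => LinearMap.flip (mulAux m n))

theorem mulL_incl (m n : ℕ) (u : ⨂[R]^(m + 1) A) (v : ⨂[R]^(n + 1) A) :
    mulL (incl m u) (incl n v) = (mulAux m n u v : Sha R A lam kap) := by
  simp [mulL, desc_incl]

theorem mulL_ofA (a : A) (w : Sha R A lam kap) : mulL (ofA a) w = act a w := by
  have h : mulL (ofA a) = (act a : Sha R A lam kap →ₗ[R] _) := by
    apply hom_ext
    intro n
    ext1
    ext v
    simp [ofA, mulL_incl, mulAux]
  exact LinearMap.congr_fun h w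

theorem mulL_cons_ofA (a b : A) (w : Sha R A lam kap) :
    mulL (cons a w) (ofA b) = cons (a * b) w := by
  have h : LinearMap.flip mulL (ofA b) ∘ₗ cons a =
      (cons (a * b) : Sha R A lam kap →ₗ[R] _) := by
    apply hom_ext
    intro n
    refine LinearMap.ext fun v => ?_
    have := act_cons (lam := lam) (kap := kap) b a (incl n v)
    rw [cons_incl] at this
    simp [ofA, cons_incl, mulL_incl, mulAux, this, mul_comm]
  exact LinearMap.congr_fun h w

/-- The defining recursion of the product. -/
theorem mulL_cons_cons (a b : A) (u v : Sha R A lam kap) :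
    mulL (cons a u) (cons b v) =
      cons (a * b) (mulL u (cons 1 v) + mulL (cons 1 u) v + lam • mulL u v)
        + kap • act (a * b) (mulL u v) := by
  have h : LinearMap.compl₂ (mulL ∘ₗ cons a) (cons b) =
      (LinearMap.compr₂ (LinearMap.compl₂ mulL (cons 1) + mulL ∘ₗ cons 1 + lam • mulL)
        (cons (a * b)) + kap • LinearMap.compr₂ mulL (act (a * b)) :
        Sha R A lam kap →ₗ[R] Sha R A lam kap →ₗ[R] _) := by
    apply hom_ext
    intro m
    refine LinearMap.ext fun x => ?_
    apply hom_ext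
    intro n
    refine LinearMap.ext fun y => ?_
    simp only [LinearMap.comp_apply, LinearMap.compl₂_apply, LinearMap.compr₂_apply,
      LinearMap.add_apply, LinearMap.smul_apply, cons_incl, mulL_incl]
    rw [mulAux, mulStep_consT]
    simp
  have := LinearMap.congr_fun₂ h u v
  simpa using this

/-- The pure tensor `a ⊗ l₁ ⊗ ⋯ ⊗ lₙ`. -/
def word : A → List A → Sha R A lam kap
  | a, [] => ofA a
  | a, b :: l => cons a (word b l)

theorem span_words :
    Submodule.span R {w : Sha R A lam kap | ∃ a l, w = word a l} = ⊤ := by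
  have key : ∀ (n : ℕ) (v : Fin (n + 1) → A), ∃ a l,
      (incl n (PiTensorProduct.tprod R v) : Sha R A lam kap) = word a l := by
    intro n
    induction n with
    | zero =>
      intro v
      refine ⟨v 0, [], ?_⟩
      have : (PiTensorProduct.tprod R v : ⨂[R]^1 A) = oneT.symm (v 0) := by
        rw [LinearEquiv.eq_symm_apply]
        simp [oneT]
      simp [word, ofA, this]
    | succ n ih =>
      intro v
      obtain ⟨b, l, h⟩ := ih (Fin.tail v)
      refine ⟨v 0, b :: l, ?_⟩
      rw [word, ← h, cons_incl, consT_tprod, Fin.cons_self_tail]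
  rw [eq_top_iff]
  rintro w -
  induction w using DirectSum.induction_on with
  | zero => exact Submodule.zero_mem _
  | of n x =>
    change incl n x ∈ _
    induction x using PiTensorProduct.induction_on with
    | smul_tprod r v =>
      rw [map_smul]
      exact Submodule.smul_mem _ _ (Submodule.subset_span (key n v))
    | add x y hx hy => rw [map_add]; exact Submodule.add_mem _ hx hy
  | add x y hx hy => exact Submodule.add_mem _ hx hy

theorem word_ext {N : Type*} [AddCommGroup N] [Module R N] {F G : Sha R A lam kap →ₗ[R] N}
    (h : ∀ a l, F (word a l) = G (word a l)) : F = G :=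
  LinearMap.ext_on span_words (by rintro _ ⟨a, l, rfl⟩; exact h a l)

theorem hom_ext_cons {N : Type*} [AddCommGroup N] [Module R N] {F G : Sha R A lam kap →ₗ[R] N}
    (h0 : ∀ a, F (ofA a) = G (ofA a))
    (h1 : ∀ a w, F w = G w → F (cons a w) = G (cons a w)) : F = G := by
  apply word_ext
  intro a l
  induction l generalizing a with
  | nil => exact h0 a
  | cons b l ih => exact h1 a _ (ih b)

theorem act_one (w : Sha R A lam kap) : act 1 w = w := by
  have h : act 1 = (LinearMap.id : Sha R A lam kap →ₗ[R] _) :=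
    hom_ext_cons (by simp [act_ofA]) (by simp [act_cons])
  exact LinearMap.congr_fun h w

theorem act_act (a b : A) (w : Sha R A lam kap) : act a (act b w) = act (a * b) w := by
  have h : act a ∘ₗ act b = (act (a * b) : Sha R A lam kap →ₗ[R] _) :=
    hom_ext_cons (by simp [act_ofA, mul_assoc]) (by simp [act_cons, mul_assoc])
  exact LinearMap.congr_fun h w

theorem cons_eq (a : A) (w : Sha R A lam kap) : cons a w = act a (shift w) := by
  rw [shift, act_cons, mul_one]

theorem mulL_comm (u v : Sha R A lam kap) : mulL u v = mulL v u := by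
  have key : ∀ (N : ℕ) (l l' : List A), l.length + l'.length = N → ∀ a b : A,
      mulL (word a l) (word b l') = (mulL (word b l') (word a l) : Sha R A lam kap) := by
    intro N
    induction N using Nat.strong_induction_on with
    | _ N ih =>
    intro l l' hN a b
    match l, l' with
    | [], [] => simp [word, mulL_ofA, act_ofA, mul_comm]
    | [], c :: l' => simp [word, mulL_ofA, act_cons, mulL_cons_ofA, mul_comm]
    | c :: l, [] => simp [word, mulL_ofA, act_cons, mulL_cons_ofA, mul_comm]
    | c :: l, d :: l' =>
      simp only [List.length_cons] at hN
      have h1 := ih _ (by simp; omega) l (d :: l') rfl c 1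
      have h2 := ih _ (by simp; omega) (c :: l) l' rfl 1 d
      have h3 := ih _ (by omega) l l' rfl c d
      simp only [word] at h1 h2 h3 ⊢
      rw [mulL_cons_cons, mulL_cons_cons, h1, h2, h3, mul_comm a b]
      congr 3
      abel
  have h : mulL = (LinearMap.flip mulL : Sha R A lam kap →ₗ[R] Sha R A lam kap →ₗ[R] _) := by
    apply word_ext
    intro a l
    apply word_ext
    intro b l'
    exact key _ l l' rfl a b
  exact LinearMap.congr_fun₂ h u v

theorem mulL_act (a : A) (u v : Sha R A lam kap) : mulL (act a u) v = act a (mulL u v) := by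
  have h : mulL ∘ₗ act a =
      (LinearMap.compr₂ mulL (act a) : Sha R A lam kap →ₗ[R] Sha R A lam kap →ₗ[R] _) := by
    apply hom_ext_cons
    · intro b
      refine LinearMap.ext fun w => ?_
      simp [act_ofA, mulL_ofA, act_act]
    · intro b u _
      refine hom_ext_cons ?_ ?_
      · intro c
        simp [act_cons, mulL_cons_ofA, mul_assoc]
      · intro c v _
        simp [act_cons, mulL_cons_cons, act_act, mul_assoc]
  exact LinearMap.congr_fun₂ h u v

theorem mulL_act_right (a : A) (u v : Sha R A lam kap) :
    mulL u (act a v) = act a (mulL u v) := by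
  rw [mulL_comm, mulL_act, mulL_comm]

theorem mulL_shift (u v : Sha R A lam kap) :
    mulL (shift u) (shift v) =
      shift (mulL u (shift v)) + shift (mulL (shift u) v) + lam • shift (mulL u v)
        + kap • mulL u v := by
  simp [shift, mulL_cons_cons, act_one]

theorem mulL_assoc (u v w : Sha R A lam kap) :
    mulL (mulL u v) w = mulL u (mulL v w) := by
  have key : ∀ (N : ℕ) (l l' l'' : List A), l.length + l'.length + l''.length = N →
      ∀ a b c : A, mulL (mulL (word a l) (word b l')) (word c l'') =
        (mulL (word a l) (mulL (word b l') (word c l'')) : Sha R A lam kap) := by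
    intro N
    induction N using Nat.strong_induction_on with
    | _ N ih =>
    intro l l' l'' hN a b c
    match l, l', l'' with
    | [], l', l'' => simp [word, mulL_ofA, mulL_act]
    | x :: l, [], l'' =>
      rw [mulL_comm _ (word b [])]
      simp [word, mulL_ofA, mulL_act, mulL_act_right]
    | x :: l, y :: l', [] =>
      rw [mulL_comm _ (word c []), mulL_comm _ (word c [])]
      simp [word, mulL_ofA, mulL_act_right]
    | x :: l, y :: l', z :: l'' =>
      simp only [List.length_cons] at hN
      have h1 := ih _ (by simp; omega) l (y :: l') (z :: l'') rfl x 1 1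
      have h2 := ih _ (by simp; omega) (x :: l) l' (z :: l'') rfl 1 y 1
      have h3 := ih _ (by simp; omega) (x :: l) (y :: l') l'' rfl 1 1 z
      have h4 := ih _ (by simp; omega) l l' (z :: l'') rfl x y 1
      have h5 := ih _ (by simp; omega) l (y :: l') l'' rfl x 1 z
      have h6 := ih _ (by simp; omega) (x :: l) l' l'' rfl 1 y z
      have h7 := ih _ (by omega) l l' l'' rfl x y z
      simp only [word, cons_eq, act_one] at h1 h2 h3 h4 h5 h6 h7 ⊢
      simp only [mulL_act, mulL_act_right]
      congr 3
      generalize (word x l : Sha R A lam kap) = U at *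
      generalize (word y l' : Sha R A lam kap) = V at *
      generalize (word z l'' : Sha R A lam kap) = W at *
      have hS : shift (mulL U (shift V) + mulL (shift U) V + lam • mulL U V) =
          mulL (shift U) (shift V) - kap • mulL U V := by
        rw [mulL_shift]; simp only [map_add, map_smul]; abel
      have hT : shift (mulL V (shift W) + mulL (shift V) W + lam • mulL V W) =
          mulL (shift V) (shift W) - kap • mulL V W := by
        rw [mulL_shift]; simp only [map_add, map_smul]; abel
      have e1 := mulL_shift (mulL U (shift V) + mulL (shift U) V + lam • mulL U V) W
      have e2 := mulL_shift U (mulL V (shift W) + mulL (shift V) W + lam • mulL V W)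
      rw [hS] at e1
      rw [hT] at e2
      simp only [map_add, map_smul, map_sub, LinearMap.add_apply, LinearMap.smul_apply,
        LinearMap.sub_apply, h1, h2, h3, h4, h5, h6, h7] at e1 e2
      rw [sub_eq_iff_eq_add] at e1 e2
      rw [e1, e2]
      module
  have k1 : ∀ a l b l', mulL (mulL (word a l) (word b l')) w =
      (mulL (word a l) (mulL (word b l') w) : Sha R A lam kap) := by
    intro a l b l'
    have h : mulL (mulL (word a l) (word b l')) =
        (mulL (word a l) ∘ₗ mulL (word b l') : Sha R A lam kap →ₗ[R] _) :=
      word_ext fun c l'' => key _ l l' l'' rfl a b c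
    exact LinearMap.congr_fun h w
  have k2 : ∀ a l, mulL (mulL (word a l) v) w =
      (mulL (word a l) (mulL v w) : Sha R A lam kap) := by
    intro a l
    have h : LinearMap.flip mulL w ∘ₗ mulL (word a l) =
        (mulL (word a l) ∘ₗ LinearMap.flip mulL w : Sha R A lam kap →ₗ[R] _) :=
      word_ext fun b l' => k1 a l b l'
    exact LinearMap.congr_fun h v
  have h : LinearMap.flip mulL w ∘ₗ LinearMap.flip mulL v =
      (LinearMap.flip mulL (mulL v w) : Sha R A lam kap →ₗ[R] _) :=
    word_ext fun a l => k2 a l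
  exact LinearMap.congr_fun h u

instance : Mul (Sha R A lam kap) := ⟨fun u v => mulL u v⟩

instance : One (Sha R A lam kap) := ⟨ofA 1⟩

theorem mul_def (u v : Sha R A lam kap) : u * v = mulL u v := rfl

theorem one_def : (1 : Sha R A lam kap) = ofA 1 := rfl

theorem one_mul_aux (u : Sha R A lam kap) : 1 * u = u := by
  rw [mul_def, one_def, mulL_ofA, act_one]

theorem mul_comm_aux (u v : Sha R A lam kap) : u * v = v * u := mulL_comm u v

/-- The commutative ring structure with the product `mulL` and unit `1 ∈ A`. -/
instance : CommRing (Sha R A lam kap) :=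
  { (inferInstance : AddCommGroup (Sha R A lam kap)) with
    mul := (· * ·)
    one := 1
    mul_assoc := mulL_assoc
    mul_comm := mul_comm_aux
    one_mul := one_mul_aux
    mul_one := fun u => by rw [mul_comm_aux, one_mul_aux]
    left_distrib := fun u v w => map_add (mulL u) v w
    right_distrib := fun u v w => by simp [mul_def]
    zero_mul := fun u => by simp [mul_def]
    mul_zero := fun u => by simp [mul_def] }

instance : Algebra R (Sha R A lam kap) :=
  Algebra.ofModule (fun c u v => by simp [mul_def]) (fun c u v => by simp [mul_def])

/-- The natural algebra embedding `j : A → Sha`. -/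
def j : A →ₐ[R] Sha R A lam kap :=
  AlgHom.ofLinearMap ofA rfl (fun a b => by rw [mul_def, mulL_ofA, act_ofA])

theorem j_apply (a : A) : (j a : Sha R A lam kap) = ofA a := rfl

theorem cons_eq_mul (a : A) (w : Sha R A lam kap) : cons a w = j a * shift w := by
  rw [j_apply, mul_def, mulL_ofA, cons_eq]

theorem shift_isExtendedRotaBaxter :
    IsExtendedRotaBaxter lam kap (shift : Sha R A lam kap →ₗ[R] Sha R A lam kap) :=
  fun x y => mulL_shift x y

section Lift

variable {S : Type*} [CommRing S] [Algebra R S]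

/-- Components of `lift`: `a ↦ f a` and `a ⊗ u ↦ f a * Q (F u)`. -/
def liftAux (f : A →ₐ[R] S) (Q : S →ₗ[R] S) : ∀ n : ℕ, (⨂[R]^(n + 1) A) →ₗ[R] S
  | 0 => f.toLinearMap ∘ₗ oneT.toLinearMap
  | n + 1 => unconsT (LinearMap.compl₂ (LinearMap.mul R S ∘ₗ f.toLinearMap)
      (Q ∘ₗ liftAux f Q n))

/-- The linear map underlying `lift`. -/
def liftLin (f : A →ₐ[R] S) (Q : S →ₗ[R] S) : Sha R A lam kap →ₗ[R] S :=
  desc (liftAux f Q)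

theorem liftLin_ofA (f : A →ₐ[R] S) (Q : S →ₗ[R] S) (a : A) :
    liftLin f Q (ofA a : Sha R A lam kap) = f a := by
  simp [liftLin, ofA, desc_incl, liftAux]

theorem liftLin_cons (f : A →ₐ[R] S) (Q : S →ₗ[R] S) (a : A) (w : Sha R A lam kap) :
    liftLin f Q (cons a w) = f a * Q (liftLin f Q w) := by
  have h : liftLin f Q ∘ₗ cons a =
      (LinearMap.mulLeft R (f a) ∘ₗ Q ∘ₗ liftLin f Q : Sha R A lam kap →ₗ[R] S) := by
    apply hom_ext
    intro n
    refine LinearMap.ext fun u => ?_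
    simp [liftLin, cons_incl, desc_incl, liftAux, unconsT_consT]
  exact LinearMap.congr_fun h w

theorem liftLin_act (f : A →ₐ[R] S) (Q : S →ₗ[R] S) (a : A) (w : Sha R A lam kap) :
    liftLin f Q (act a w) = f a * liftLin f Q w := by
  have h : liftLin f Q ∘ₗ act a =
      (LinearMap.mulLeft R (f a) ∘ₗ liftLin f Q : Sha R A lam kap →ₗ[R] S) := by
    apply hom_ext_cons
    · intro b; simp [act_ofA, liftLin_ofA]
    · intro b u _; simp [act_cons, liftLin_cons, mul_assoc]
  exact LinearMap.congr_fun h w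

theorem liftLin_mul (f : A →ₐ[R] S) (Q : S →ₗ[R] S) (hQ : IsExtendedRotaBaxter lam kap Q)
    (u v : Sha R A lam kap) : liftLin f Q (u * v) = liftLin f Q u * liftLin f Q v := by
  have key : ∀ (N : ℕ) (l l' : List A), l.length + l'.length = N → ∀ a b : A,
      liftLin f Q (mulL (word a l) (word b l') : Sha R A lam kap) =
        liftLin f Q (word a l : Sha R A lam kap) *
          liftLin f Q (word b l' : Sha R A lam kap) := by
    intro N
    induction N using Nat.strong_induction_on with
    | _ N ih =>
    intro l l' hN a b
    match l, l' with
    | [], l' => simp [word, mulL_ofA, liftLin_act, liftLin_ofA]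
    | c :: l, [] =>
      rw [mulL_comm]
      simp [word, mulL_ofA, liftLin_act, liftLin_ofA, mul_comm]
    | c :: l, d :: l' =>
      simp only [List.length_cons] at hN
      have h1 := ih _ (by simp; omega) l (d :: l') rfl c 1
      have h2 := ih _ (by simp; omega) (c :: l) l' rfl 1 d
      have h3 := ih _ (by omega) l l' rfl c d
      simp only [word] at h1 h2 h3 ⊢
      rw [mulL_cons_cons]
      simp only [map_add, map_smul, liftLin_cons, liftLin_act, h1, h2, h3, map_one, one_mul,
        map_mul]
      have e := hQ (liftLin f Q (word c l : Sha R A lam kap))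
        (liftLin f Q (word d l' : Sha R A lam kap))
      simp only [Algebra.smul_def] at e ⊢
      linear_combination (- f a * f b) * e
  have k1 : ∀ a l, liftLin f Q (mulL (word a l) v : Sha R A lam kap) =
      liftLin f Q (word a l : Sha R A lam kap) * liftLin f Q v := by
    intro a l
    have h : liftLin f Q ∘ₗ mulL (word a l) =
        (LinearMap.mulLeft R (liftLin f Q (word a l : Sha R A lam kap)) ∘ₗ liftLin f Q :
          Sha R A lam kap →ₗ[R] S) :=
      word_ext fun b l' => key _ l l' rfl a b
    exact LinearMap.congr_fun h v
  have h : liftLin f Q ∘ₗ LinearMap.flip mulL v =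
      (LinearMap.mulRight R (liftLin f Q v) ∘ₗ liftLin f Q : Sha R A lam kap →ₗ[R] S) :=
    word_ext fun a l => k1 a l
  exact LinearMap.congr_fun h u

/-- The homomorphism of extended Rota-Baxter algebras `(Sha, shift) → (S, Q)` that extends an
algebra homomorphism `f : A → S`. -/
def lift (f : A →ₐ[R] S) (Q : S →ₗ[R] S) (hQ : IsExtendedRotaBaxter lam kap Q) :
    Sha R A lam kap →ₐ[R] S :=
  AlgHom.ofLinearMap (liftLin f Q)
    (by rw [one_def, liftLin_ofA, map_one]) (liftLin_mul f Q hQ)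

/-- The universal property of the free commutative extended Rota-Baxter algebra: `lift f Q` is
the one and only homomorphism `(Sha, shift) → (S, Q)` that restricts to `f` on `A`. -/
theorem eq_lift_iff (f : A →ₐ[R] S) (Q : S →ₗ[R] S) (hQ : IsExtendedRotaBaxter lam kap Q)
    (F : Sha R A lam kap →ₐ[R] S) :
    ((∀ a, F (j a) = f a) ∧ ∀ w, F (shift w) = Q (F w)) ↔ F = lift f Q hQ := by
  constructor
  · rintro ⟨h0, h1⟩
    have h : F.toLinearMap = liftLin f Q := by
      apply hom_ext_cons
      · intro a; rw [liftLin_ofA]; exact h0 a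
      · intro a w hw
        rw [liftLin_cons, ← hw, cons_eq_mul]
        simp [h0, h1]
    exact AlgHom.toLinearMap_injective h
  · rintro rfl
    refine ⟨fun a => liftLin_ofA (lam := lam) (kap := kap) f Q a, fun w => ?_⟩
    change liftLin f Q (cons 1 w) = _
    rw [liftLin_cons, map_one, one_mul]
    rfl

end Lift

end Sha

section Bialgebra

variable {R A : Type*} [CommRing R] [CommRing A] [Bialgebra R A] {lam kap mu : R}

theorem isExtendedRotaBaxter_neg_smul (hmu : mu ^ 2 - lam * mu + kap = 0) :
    IsExtendedRotaBaxter lam kap (-(mu • LinearMap.id) : R →ₗ[R] R) := by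
  intro x y
  simp only [LinearMap.neg_apply, LinearMap.smul_apply, LinearMap.id_apply, smul_eq_mul]
  linear_combination (-x * y) * hmu

/-- The counit of `Sha`: the unique homomorphism of extended Rota-Baxter algebras
`(Sha, shift) → (R, -mu id)` that restricts to the counit of `A`. -/
def counit (hmu : mu ^ 2 - lam * mu + kap = 0) : Sha R A lam kap →ₐ[R] R :=
  Sha.lift (Bialgebra.counitAlgHom R A) (-(mu • LinearMap.id))
    (isExtendedRotaBaxter_neg_smul hmu)

theorem eq_counit_iff (hmu : mu ^ 2 - lam * mu + kap = 0) (F : Sha R A lam kap →ₐ[R] R) :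
    ((∀ a : A, F (Sha.j a) = Coalgebra.counit a) ∧ ∀ w, F (Sha.shift w) = -(mu * F w)) ↔
      F = counit hmu := by
  have h := Sha.eq_lift_iff (Bialgebra.counitAlgHom R A) _ (isExtendedRotaBaxter_neg_smul hmu) F
  simpa [counit] using h

theorem counit_shift (hmu : mu ^ 2 - lam * mu + kap = 0) (w : Sha R A lam kap) :
    counit hmu (Sha.shift w) = -(mu * counit hmu w) := by
  have := ((Sha.eq_lift_iff _ _ (isExtendedRotaBaxter_neg_smul hmu) (counit (A := A) hmu)).2
    rfl).2 w
  simpa using this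

/-- The operator `u ⊗ v ↦ P(u) ⊗ ε(v)1 + mu u ⊗ ε(v)1 + u ⊗ P(v)` on `Sha ⊗ Sha`. -/
def barShift (hmu : mu ^ 2 - lam * mu + kap = 0) :
    Sha R A lam kap ⊗[R] Sha R A lam kap →ₗ[R] Sha R A lam kap ⊗[R] Sha R A lam kap :=
  TensorProduct.map Sha.shift (Algebra.linearMap R _ ∘ₗ (counit hmu).toLinearMap)
    + mu • TensorProduct.map LinearMap.id (Algebra.linearMap R _ ∘ₗ (counit hmu).toLinearMap)
    + TensorProduct.map LinearMap.id Sha.shift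

theorem barShift_tmul (hmu : mu ^ 2 - lam * mu + kap = 0) (u v : Sha R A lam kap) :
    barShift hmu (u ⊗ₜ[R] v) =
      Sha.shift u ⊗ₜ[R] (counit hmu v • 1) + mu • (u ⊗ₜ[R] (counit hmu v • 1))
        + u ⊗ₜ[R] Sha.shift v := by
  simp [barShift, Algebra.algebraMap_eq_smul_one]

theorem barShift_isExtendedRotaBaxter (hmu : mu ^ 2 - lam * mu + kap = 0) :
    IsExtendedRotaBaxter lam kap (barShift (A := A) hmu) := by
  intro x y
  induction x with
  | zero => simp
  | add x x' hx hx' =>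
    simp only [map_add, add_mul, hx, hx', smul_add]; abel
  | tmul a b =>
  induction y with
  | zero => simp
  | add y y' hy hy' =>
    simp only [map_add, mul_add, hy, hy', smul_add]; abel
  | tmul c d =>
    have h1 := Sha.shift_isExtendedRotaBaxter a c
    have h2 := Sha.shift_isExtendedRotaBaxter b d
    have hk : kap = lam * mu - mu ^ 2 := by linear_combination hmu
    simp only [barShift_tmul, add_mul, mul_add, Algebra.TensorProduct.tmul_mul_tmul, map_add,
      map_smul, TensorProduct.tmul_smul, smul_mul_assoc, mul_smul_comm, mul_one, one_mul,
      h1, h2, counit_shift, map_mul, TensorProduct.add_tmul, TensorProduct.tmul_add,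
      ← TensorProduct.smul_tmul']
    generalize (counit hmu b) = x at *
    generalize (counit hmu d) = y at *
    rw [hk]
    module

/-- The coproduct of `Sha`: the unique homomorphism of extended Rota-Baxter algebras
`(Sha, shift) → (Sha ⊗ Sha, barShift)` that restricts to the coproduct of `A`. -/
def coproduct (hmu : mu ^ 2 - lam * mu + kap = 0) :
    Sha R A lam kap →ₐ[R] Sha R A lam kap ⊗[R] Sha R A lam kap :=
  Sha.lift ((Algebra.TensorProduct.map Sha.j Sha.j).comp (Bialgebra.comulAlgHom R A))
    (barShift hmu) (barShift_isExtendedRotaBaxter hmu)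

theorem eq_coproduct_iff (hmu : mu ^ 2 - lam * mu + kap = 0)
    (F : Sha R A lam kap →ₐ[R] Sha R A lam kap ⊗[R] Sha R A lam kap) :
    ((∀ a : A, F (Sha.j a) = Algebra.TensorProduct.map Sha.j Sha.j (Coalgebra.comul (R := R) a)) ∧
      ∀ w, F (Sha.shift w) = barShift hmu (F w)) ↔ F = coproduct hmu :=
  Sha.eq_lift_iff ((Algebra.TensorProduct.map Sha.j Sha.j).comp (Bialgebra.comulAlgHom R A)) _
    (barShift_isExtendedRotaBaxter hmu) F

end Bialgebra

end ExtendedRotaBaxter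

end

namespace ExtendedRotaBaxter

section Counit

variable {R A : Type*} [CommRing R] [CommRing A] [Bialgebra R A] {lam kap mu : R}

theorem counit_j (hmu : mu ^ 2 - lam * mu + kap = 0) (a : A) :
    counit hmu (Sha.j a : Sha R A lam kap) = Coalgebra.counit a :=
  ((eq_counit_iff hmu (counit (A := A) hmu)).2 rfl).1 a

theorem coproduct_j (hmu : mu ^ 2 - lam * mu + kap = 0) (a : A) :
    coproduct hmu (Sha.j a : Sha R A lam kap) =
      Algebra.TensorProduct.map Sha.j Sha.j (Coalgebra.comul (R := R) a) :=
  ((eq_coproduct_iff hmu (coproduct (A := A) hmu)).2 rfl).1 a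

theorem coproduct_shift (hmu : mu ^ 2 - lam * mu + kap = 0) (w : Sha R A lam kap) :
    coproduct hmu (Sha.shift w) = barShift hmu (coproduct hmu w) :=
  ((eq_coproduct_iff hmu (coproduct (A := A) hmu)).2 rfl).2 w

/-- The algebra homomorphism `u ⊗ v ↦ ε(v) u` from `Sha ⊗ Sha` to `Sha`. -/
def idTensorCounit (hmu : mu ^ 2 - lam * mu + kap = 0) :
    Sha R A lam kap ⊗[R] Sha R A lam kap →ₐ[R] Sha R A lam kap :=
  (Algebra.TensorProduct.rid R R (Sha R A lam kap)).toAlgHom.comp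
    (Algebra.TensorProduct.map (AlgHom.id R _) (counit hmu))

theorem idTensorCounit_tmul (hmu : mu ^ 2 - lam * mu + kap = 0) (u v : Sha R A lam kap) :
    idTensorCounit hmu (u ⊗ₜ[R] v) = counit hmu v • u := by
  simp [idTensorCounit]

theorem idTensorCounit_map_j (hmu : mu ^ 2 - lam * mu + kap = 0) (x : A ⊗[R] A) :
    idTensorCounit hmu (Algebra.TensorProduct.map Sha.j Sha.j x) =
      (Sha.j (TensorProduct.rid R A (Coalgebra.counit.lTensor A x)) : Sha R A lam kap) := by
  induction x with
  | zero => simp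
  | add x y hx hy => simp only [map_add, hx, hy]
  | tmul a b => simp [idTensorCounit_tmul, counit_j]

theorem idTensorCounit_barShift (hmu : mu ^ 2 - lam * mu + kap = 0)
    (x : Sha R A lam kap ⊗[R] Sha R A lam kap) :
    idTensorCounit hmu (barShift hmu x) = Sha.shift (idTensorCounit hmu x) := by
  induction x with
  | zero => simp
  | add x y hx hy => simp only [map_add, hx, hy]
  | tmul u v =>
    simp only [barShift_tmul, map_add, map_smul, idTensorCounit_tmul, counit_shift, map_one,
      smul_eq_mul, mul_one]
    module

/-- The counit law `(id ⊗ ε) Δ = id` of `Sha`. -/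
theorem idTensorCounit_coproduct (hmu : mu ^ 2 - lam * mu + kap = 0) (w : Sha R A lam kap) :
    idTensorCounit hmu (coproduct hmu w) = w := by
  have h : (idTensorCounit hmu).comp (coproduct hmu) = AlgHom.id R (Sha R A lam kap) := by
    refine Eq.trans ((Sha.eq_lift_iff Sha.j Sha.shift Sha.shift_isExtendedRotaBaxter _).1
      ⟨fun a => ?_, fun w => ?_⟩)
      ((Sha.eq_lift_iff Sha.j Sha.shift Sha.shift_isExtendedRotaBaxter _).1
        ⟨fun _ => rfl, fun _ => rfl⟩).symm
    · rw [AlgHom.comp_apply, coproduct_j, idTensorCounit_map_j, Coalgebra.lTensor_counit_comul]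
      simp
    · rw [AlgHom.comp_apply, coproduct_shift, idTensorCounit_barShift, AlgHom.comp_apply]
  exact AlgHom.congr_fun h w

theorem barShift_eq (hmu : mu ^ 2 - lam * mu + kap = 0)
    (x : Sha R A lam kap ⊗[R] Sha R A lam kap) :
    barShift hmu x =
      (Sha.shift (idTensorCounit hmu x) + mu • idTensorCounit hmu x) ⊗ₜ[R]
          (1 : Sha R A lam kap)
        + TensorProduct.map LinearMap.id Sha.shift x := by
  induction x with
  | zero => simp
  | add x y hx hy =>
    simp only [map_add, hx, hy, smul_add, TensorProduct.add_tmul]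
    abel
  | tmul u v =>
    simp only [barShift_tmul, idTensorCounit_tmul, map_smul, TensorProduct.map_tmul,
      LinearMap.id_apply, TensorProduct.add_tmul, TensorProduct.tmul_smul,
      ← TensorProduct.smul_tmul']

end Counit

end ExtendedRotaBaxter

theorem mainTheorem7 {R A : Type*} [CommRing R] [CommRing A] [Bialgebra R A]
    (lam kap mu : R) (hmu : mu ^ 2 - lam * mu + kap = 0)
    (a : ExtendedRotaBaxter.Sha R A lam kap) :
    ExtendedRotaBaxter.coproduct hmu (ExtendedRotaBaxter.Sha.shift a) =
      (ExtendedRotaBaxter.Sha.shift a + mu • a) ⊗ₜ[R]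
          (1 : ExtendedRotaBaxter.Sha R A lam kap)
        + TensorProduct.map LinearMap.id ExtendedRotaBaxter.Sha.shift
            (ExtendedRotaBaxter.coproduct hmu a) := by
  rw [ExtendedRotaBaxter.coproduct_shift, ExtendedRotaBaxter.barShift_eq,
    ExtendedRotaBaxter.idTensorCounit_coproduct]
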